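/- Let $Y=[0,2\pi)^d$ and $Y'=[-\tfrac12,\tfrac12)^d$, and let $A=(a_{jk})_{j,k=1}^d$ be a matrix of real, bounded, measurable functions on $\mathbb{R}^d$ that is $Y$-periodic ($A(y+2\pi p)=A(y)$ for all $p\in\mathbb{Z}^d$ and a.e. $y$), symmetric, and elliptic: there is $\alpha>0$ with $A(y)\xi\cdot\xi\ge\alpha|\xi|^2$ for all $\xi\in\mathbb{R}^d$ and a.e. $y$. Let $L^2_\sharp(Y)$ be the space of complex-valued $Y$-periodic functions that are square integrable over $Y$, and let $H^2_\sharp(Y)$ be the space of those $u\in L^2_\sharp(Y)$ whose Fourier coefficients $\hat u(n)$ satisfy $\|u\|_{H^2}^2=\sum_{n\in\mathbb{Z}^d}(1+|n|^2)^2|\hat u(n)|^2<\infty$. For $\rho>0$ and $\eta\in\mathbb{R}^d$ let $\mathcal{A}^\rho(\eta)=\rho^2(\nabla+i\eta)^4-(\nabla+i\eta)\cdot A(y)(\nabla+i\eta)$ be the operator associated with the form $$a^\rho[\eta](u,v)=\int_Y A(\nabla+i\eta)u\cdot\overline{(\nabla+i\eta)v}\,dy+\rho^2\int_Y(\nabla+i\eta)^2u\,\overline{(\nabla+i\eta)^2v}\,dy,\qquad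 u,v\in H^2_\sharp(Y).$$ Thus $\phi$ is an eigenfunction of $\mathcal{A}^\rho(\eta)$ for the eigenvalue $\lambda$ if $0\ne\phi\in H^2_\sharp(Y)$ and $a^\rho[\eta](\phi,v)=\lambda\int_Y\phi\,\overline{v}\,dy$ for all $v\in H^2_\sharp(Y)$. The eigenvalues are real, and the first Bloch eigenvalue $\lambda_1^\rho(\eta)$ is the smallest one. **Theorem.** For every $\rho>0$ there exist $\delta_\rho>0$ and a ball $U^\rho=\{\eta\in\mathbb{R}^d:|\eta|<\delta_\rho\}\subseteq Y'$ such that 1. for every $\eta\in U^\rho$ the operator $\mathcal{A}^\rho(\eta)$ has a smallest eigenvalue $\lambda_1^\rho(\eta)$, and $\eta\mapsto\lambda_1^\rho(\eta)$ is (real) analytic on $U^\rho$; 2. there is a choice of corresponding eigenfunctions $\phi_1^\rho(\cdot,\eta)$, $\eta\in U^\rho$, such that $\eta\mapsto\phi_1^\rho(\cdot,\eta)\in H^2_\sharp(Y)$ is analytic on $U^\rho$. -/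

import Mathlib

open MeasureTheory Set
open scoped Real ENNReal ComplexConjugate

noncomputable section

namespace BlochWave

/-! ### The periodicity cell and `L²` of periodic functions -/

/-- The basic periodicity cell `Y = [0, 2π)^d`. -/
def cell (d : ℕ) : Set (Fin d → ℝ) := Set.univ.pi fun _ => Ico 0 (2 * π)

/-- Lebesgue measure on the periodicity cell. -/
def cellMeasure (d : ℕ) : Measure (Fin d → ℝ) := volume.restrict (cell d)

/-- The dual cell `Y' = [-1/2, 1/2)^d`. -/
def dualCell (d : ℕ) : Set (EuclideanSpace ℝ (Fin d)) :=
  {η | ∀ j, η j ∈ Ico (-(1 / 2) : ℝ) (1 / 2)}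

/-- The space `L²_♯(Y)` of complex valued periodic functions that are square integrable over a
period; such a function is determined by its restriction to `Y`. -/
abbrev L2 (d : ℕ) : Type := Lp ℂ 2 (cellMeasure d)

/-- The exponential `y ↦ (2π)^{-d/2} exp(i n·y)`, for a frequency `n ∈ ℤ^d`, written as a product
over the coordinates. -/
def expFun {d : ℕ} (n : Fin d → ℤ) (y : Fin d → ℝ) : ℂ :=
  ∏ j, ((√(2 * π) : ℂ)⁻¹ * Complex.exp (Complex.I * n j * y j))

theorem cellMeasure_eq_pi (d : ℕ) :
    cellMeasure d = Measure.pi fun _ : Fin d => (volume : Measure ℝ).restrict (Ico 0 (2 * π)) :=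
  Measure.restrict_pi_pi _ _

instance (d : ℕ) : IsFiniteMeasure (cellMeasure d) := by
  rw [cellMeasure_eq_pi]; infer_instance

theorem continuous_expFun {d : ℕ} (n : Fin d → ℤ) : Continuous (expFun n) := by
  unfold expFun; fun_prop

theorem norm_expFun {d : ℕ} (n : Fin d → ℤ) (y : Fin d → ℝ) :
    ‖expFun n y‖ = (√(2 * π))⁻¹ ^ d := by
  have h : ∀ j : Fin d, ‖Complex.exp (Complex.I * n j * y j)‖ = 1 := by
    intro j
    have := Complex.norm_exp_ofReal_mul_I ((n j : ℝ) * y j)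
    rw [← this]; congr 2; push_cast; ring
  simp [expFun, norm_prod, h, abs_of_nonneg (Real.sqrt_nonneg _)]

theorem memLp_expFun {d : ℕ} (n : Fin d → ℤ) : MemLp (expFun n) 2 (cellMeasure d) :=
  MemLp.of_bound (continuous_expFun n).aestronglyMeasurable ((√(2 * π))⁻¹ ^ d)
    (Filter.Eventually.of_forall fun y => (norm_expFun n y).le)

/-- The normalized exponential of frequency `n` as an element of `L²_♯(Y)`. -/
def expL2 {d : ℕ} (n : Fin d → ℤ) : L2 d := (memLp_expFun n).toLp _

theorem integral_exp_cell (k : ℤ) :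
    ∫ t : ℝ in Ico 0 (2 * π), Complex.exp (Complex.I * k * t) = if k = 0 then (2 * π : ℂ) else 0 := by
  rw [integral_Ico_eq_integral_Ioc, ← intervalIntegral.integral_of_le (by positivity)]
  split_ifs with hk
  · subst hk; simp
  · have hc : Complex.I * (k : ℂ) ≠ 0 := by simp [hk]
    rw [integral_exp_mul_complex hc]
    have : Complex.exp (Complex.I * k * ((2 * π : ℝ) : ℂ)) = 1 := by
      rw [← Complex.exp_int_mul_two_pi_mul_I k]; congr 1; push_cast; ring
    rw [this]; simp

theorem orthonormal_expL2 (d : ℕ) : Orthonormal ℂ (expL2 (d := d)) := by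
  rw [orthonormal_iff_ite]
  intro m n
  have h1 : inner ℂ (expL2 m) (expL2 n) = ∫ y, conj (expFun m y) * expFun n y ∂(cellMeasure d) := by
    rw [L2.inner_def]
    apply integral_congr_ae
    filter_upwards [(memLp_expFun m).coeFn_toLp, (memLp_expFun n).coeFn_toLp] with y h1 h2
    simp only [expL2, h1, h2, RCLike.inner_apply]
    ring
  have hs : ((√(2 * π) : ℂ)⁻¹ * (√(2 * π) : ℂ)⁻¹) * (2 * π) = 1 := by
    have h0 : (√(2 * π)) ≠ 0 := by positivity
    have h2 : (√(2 * π)) * (√(2 * π)) = 2 * π := Real.mul_self_sqrt (by positivity)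
    have h3 : ((√(2 * π))⁻¹ * (√(2 * π))⁻¹) * (2 * π) = 1 := by
      nth_rewrite 3 [← h2]; field_simp
    exact_mod_cast h3
  have h2 : ∀ y : Fin d → ℝ, conj (expFun m y) * expFun n y
      = ∏ j, ((√(2 * π) : ℂ)⁻¹ * (√(2 * π) : ℂ)⁻¹) *
        Complex.exp (Complex.I * (n j - m j : ℤ) * y j) := by
    intro y
    simp only [expFun, map_prod, ← Finset.prod_mul_distrib]
    refine Finset.prod_congr rfl fun j _ => ?_
    rw [map_mul, ← Complex.exp_conj]
    simp only [map_mul, map_inv₀, Complex.conj_ofReal, Complex.conj_I, map_intCast]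
    rw [mul_mul_mul_comm, ← Complex.exp_add]
    congr 2; push_cast; ring
  rw [h1]
  simp_rw [h2]
  rw [cellMeasure_eq_pi]
  rw [integral_fintype_prod_eq_prod (μ := fun _ : Fin d => (volume : Measure ℝ).restrict (Ico 0 (2 * π)))
    (fun (j : Fin d) (t : ℝ) => ((√(2 * π) : ℂ)⁻¹ * (√(2 * π) : ℂ)⁻¹) *
        Complex.exp (Complex.I * (n j - m j : ℤ) * t))]
  simp_rw [integral_const_mul, integral_exp_cell]
  split_ifs with h
  · subst h
    simp only [sub_self, if_true, hs, Finset.prod_const_one]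
  · obtain ⟨j, hj⟩ := Function.ne_iff.mp h
    refine Finset.prod_eq_zero (Finset.mem_univ j) ?_
    rw [if_neg (by omega), mul_zero]

/-- Auxiliary parametrization of the interval by the unit circle. -/
def circleLift (x : UnitAddCircle) : ℝ := 2 * π * (AddCircle.equivIoc 1 0 x : ℝ)

theorem measurable_circleLift : Measurable circleLift :=
  (measurable_subtype_coe.comp (AddCircle.measurableEquivIoc 1 0).measurable).const_mul _

theorem coe_circleLift (x : UnitAddCircle) : (((2 * π)⁻¹ * circleLift x : ℝ) : UnitAddCircle) = x := by
  have : (2 * π)⁻¹ * circleLift x = (AddCircle.equivIoc 1 0 x : ℝ) := by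
    unfold circleLift; field_simp
  rw [this]
  exact (AddCircle.equivIoc (1 : ℝ) 0).symm_apply_apply x

theorem measurePreserving_circleLift :
    MeasurePreserving circleLift (AddCircle.haarAddCircle : Measure UnitAddCircle)
      (ENNReal.ofReal (2 * π)⁻¹ • (volume : Measure ℝ).restrict (Ico 0 (2 * π))) := by
  refine ⟨measurable_circleLift, ?_⟩
  have hh : (AddCircle.haarAddCircle : Measure UnitAddCircle) = (volume : Measure (AddCircle (1 : ℝ))) := by
    rw [AddCircle.volume_eq_smul_haarAddCircle]; simp
  rw [hh, ← (AddCircle.measurePreserving_mk 1 0).map_eq,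
    Measure.map_map measurable_circleLift AddCircle.measurable_mk']
  have hcongr : (circleLift ∘ (QuotientAddGroup.mk : ℝ → AddCircle (1 : ℝ)))
      =ᵐ[volume.restrict (Ioc (0 : ℝ) (0 + 1))] fun t => 2 * π * t := by
    filter_upwards [ae_restrict_mem measurableSet_Ioc] with t ht
    have h : (AddCircle.equivIoc 1 0 (t : AddCircle (1 : ℝ)) : ℝ) = t :=
      congrArg Subtype.val ((AddCircle.equivIoc (1 : ℝ) 0).apply_symm_apply ⟨t, ht⟩)
    simp only [Function.comp, circleLift]
    exact congrArg (fun s => 2 * π * s) h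
  rw [Measure.map_congr hcongr]
  have hpi : (2 * π) ≠ 0 := by positivity
  have hemb : MeasurableEmbedding fun t : ℝ => 2 * π * t :=
    (Homeomorph.mulLeft₀ (2 * π) hpi).measurableEmbedding
  have hpre : (fun t : ℝ => 2 * π * t) ⁻¹' (Ioc 0 (2 * π)) = Ioc 0 (0 + 1) := by
    ext t
    have : (0 : ℝ) < 2 * π := by positivity
    simp only [mem_preimage, mem_Ioc, zero_add]
    constructor
    · rintro ⟨h1, h2⟩; exact ⟨pos_of_mul_pos_right h1 this.le |>.trans_le le_rfl, by nlinarith⟩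
    · rintro ⟨h1, h2⟩; exact ⟨by positivity, by nlinarith⟩
  rw [← hpre, ← hemb.restrict_map, Real.map_volume_mul_left hpi, Measure.restrict_smul,
    abs_of_pos (by positivity), Measure.restrict_congr_set Ico_ae_eq_Ioc]

/-- Auxiliary parametrization of the cell by the unit torus. -/
def torusLift {d : ℕ} (x : UnitAddTorus (Fin d)) : Fin d → ℝ := fun j => circleLift (x j)

theorem measurePreserving_torusLift (d : ℕ) :
    MeasurePreserving (torusLift (d := d))
      (Measure.pi fun _ => (AddCircle.haarAddCircle : Measure UnitAddCircle))
      (ENNReal.ofReal (2 * π)⁻¹ ^ d • cellMeasure d) := by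
  have h := measurePreserving_pi
    (fun _ : Fin d => (AddCircle.haarAddCircle : Measure UnitAddCircle))
    (fun _ : Fin d => ENNReal.ofReal (2 * π)⁻¹ • (volume : Measure ℝ).restrict (Ico 0 (2 * π)))
    (hν := fun _ => by
      have : IsFiniteMeasure (ENNReal.ofReal (2 * π)⁻¹ •
        (volume : Measure ℝ).restrict (Ico 0 (2 * π))) := Measure.smul_finite _ ENNReal.ofReal_ne_top
      infer_instance)
    (fun _ => measurePreserving_circleLift)
  have he : (Measure.pi fun _ : Fin d =>
      ENNReal.ofReal (2 * π)⁻¹ • (volume : Measure ℝ).restrict (Ico 0 (2 * π)))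
      = ENNReal.ofReal (2 * π)⁻¹ ^ d • cellMeasure d := by
    have : IsFiniteMeasure (ENNReal.ofReal (2 * π)⁻¹ •
        (volume : Measure ℝ).restrict (Ico 0 (2 * π))) := Measure.smul_finite _ ENNReal.ofReal_ne_top
    refine Measure.pi_eq fun s _ => ?_
    rw [cellMeasure_eq_pi, Measure.smul_apply, Measure.pi_pi]
    simp [Finset.prod_mul_distrib]
  rw [he] at h
  exact h

theorem mFourier_eq_expFun {d : ℕ} (n : Fin d → ℤ) (x : UnitAddTorus (Fin d)) :
    UnitAddTorus.mFourier (-n) x = (√(2 * π) : ℂ) ^ d * conj (expFun n (torusLift x)) := by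
  have h0 : (√(2 * π) : ℂ) ≠ 0 := by
    have : (√(2 * π)) ≠ 0 := by positivity
    exact_mod_cast this
  have hx : ∀ j, x j = (((2 * π)⁻¹ * torusLift x j : ℝ) : UnitAddCircle) :=
    fun j => (coe_circleLift (x j)).symm
  have hc : (√(2 * π) : ℂ) ^ d = ∏ _j : Fin d, (√(2 * π) : ℂ) := by simp
  simp only [UnitAddTorus.mFourier, ContinuousMap.coe_mk, expFun, map_prod, hc,
    ← Finset.prod_mul_distrib]
  refine Finset.prod_congr rfl fun j _ => ?_
  rw [hx j, fourier_coe_apply, map_mul, ← Complex.exp_conj]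
  simp only [map_mul, map_inv₀, Complex.conj_ofReal, Complex.conj_I, map_intCast]
  rw [mul_inv_cancel_left₀ h0]
  congr 1
  have : (π : ℂ) ≠ 0 := by exact_mod_cast Real.pi_ne_zero
  simp only [Pi.neg_apply]
  push_cast
  field_simp

theorem expL2_orthogonal_eq_bot (d : ℕ) :
    (Submodule.span ℂ (Set.range (expL2 (d := d))))ᗮ = ⊥ := by
  rw [Submodule.eq_bot_iff]
  intro u hu
  have hz : ∀ n, ∫ y, conj (expFun n y) * u y ∂(cellMeasure d) = 0 := by
    intro n
    have h := Submodule.inner_right_of_mem_orthogonal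
      (Submodule.subset_span (Set.mem_range_self n)) hu
    rw [← h, L2.inner_def]
    apply integral_congr_ae
    filter_upwards [(memLp_expFun n).coeFn_toLp] with y h1
    simp only [expL2, h1, RCLike.inner_apply]
    ring
  set c : ℝ≥0∞ := ENNReal.ofReal (2 * π)⁻¹ ^ d with hc
  have hc0 : c ≠ 0 := by
    have : (0 : ℝ) < (2 * π)⁻¹ := by positivity
    simp only [hc]; exact pow_ne_zero _ (by simpa using this)
  have hct : c ≠ ∞ := ENNReal.pow_ne_top ENNReal.ofReal_ne_top
  have hmp := measurePreserving_torusLift d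
  have hu2 : MemLp u 2 (c • cellMeasure d) := (Lp.memLp u).smul_measure hct
  have hw := hu2.comp_measurePreserving hmp
  set w := hw.toLp with hwdef
  have hw0 : w = 0 := by
    have hcoef : ∀ n, UnitAddTorus.mFourierBasis.repr w n = 0 := by
      intro n
      rw [UnitAddTorus.mFourierBasis_repr, UnitAddTorus.mFourierCoeff]
      have e1 : ∫ x, UnitAddTorus.mFourier (-n) x • w x
            ∂(Measure.pi fun _ => (AddCircle.haarAddCircle : Measure UnitAddCircle))
          = ∫ x, (fun y => (√(2 * π) : ℂ) ^ d * (conj (expFun n y) * u y)) (torusLift x)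
            ∂(Measure.pi fun _ => (AddCircle.haarAddCircle : Measure UnitAddCircle)) := by
        apply integral_congr_ae
        filter_upwards [hw.coeFn_toLp] with x hx
        rw [hwdef, hx, mFourier_eq_expFun, smul_eq_mul, Function.comp]
        ring
      refine e1.trans ?_
      have hmeas : AEStronglyMeasurable
          (fun y => (√(2 * π) : ℂ) ^ d * (conj (expFun n y) * u y)) (c • cellMeasure d) := by
        refine AEStronglyMeasurable.smul_measure ?_ c
        refine AEStronglyMeasurable.const_mul ?_ _
        refine AEStronglyMeasurable.mul ?_ (Lp.aestronglyMeasurable u)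
        exact (Complex.continuous_conj.comp (continuous_expFun n)).aestronglyMeasurable
      have e2 := integral_map hmp.measurable.aemeasurable
        (f := fun y => (√(2 * π) : ℂ) ^ d * (conj (expFun n y) * u y))
        (by rw [hmp.map_eq]; exact hmeas)
      rw [← e2, hmp.map_eq, integral_smul_measure, integral_const_mul, hz n]
      simp
    have : UnitAddTorus.mFourierBasis.repr w = 0 := by
      ext n; simpa using hcoef n
    simpa using this
  have hu0 : ∀ᵐ y ∂(c • cellMeasure d), u y = 0 := by
    have h1 : (u ∘ torusLift) =ᵐ[Measure.pi fun _ => (AddCircle.haarAddCircle : Measure UnitAddCircle)] 0 := by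
      have h2 := hw.coeFn_toLp
      rw [← hwdef, hw0] at h2
      exact h2.symm.trans (Lp.coeFn_zero _ _ _)
    rw [← hmp.map_eq]
    have hmu : AEMeasurable u (c • cellMeasure d) := hu2.aestronglyMeasurable.aemeasurable
    rw [← hmp.map_eq] at hmu
    rw [ae_map_iff hmp.measurable.aemeasurable]
    · exact h1
    · exact (Lp.stronglyMeasurable u).measurable (measurableSet_singleton 0)
  rw [Measure.ae_ennreal_smul_measure_eq hc0] at hu0
  exact (Lp.eq_zero_iff_ae_eq_zero).mpr hu0

/-- The normalized exponentials form a Hilbert basis of `L²_♯(Y)`. For `u ∈ L²_♯(Y)`,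
`expBasis d |>.repr u n` is the `n`-th Fourier coefficient
`û(n) = (2π)^{-d/2} ∫_Y u(y) exp(-i n·y) dy`. -/
def expBasis (d : ℕ) : HilbertBasis (Fin d → ℤ) ℂ (L2 d) :=
  HilbertBasis.mkOfOrthogonalEqBot (orthonormal_expL2 d) (expL2_orthogonal_eq_bot d)

theorem coe_expBasis (d : ℕ) : ⇑(expBasis d) = expL2 :=
  HilbertBasis.coe_mkOfOrthogonalEqBot _ _

theorem expBasis_repr {d : ℕ} (u : L2 d) (n : Fin d → ℤ) :
    (expBasis d).repr u n = ∫ y, conj (expFun n y) * u y ∂(cellMeasure d) := by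
  rw [HilbertBasis.repr_apply_apply, coe_expBasis, L2.inner_def]
  apply integral_congr_ae
  filter_upwards [(memLp_expFun n).coeFn_toLp] with y h1
  simp only [expL2, h1, RCLike.inner_apply]
  ring

/-! ### The periodic Sobolev space `H²_♯(Y)` -/

/-- `|n|²` for a frequency `n ∈ ℤ^d`. -/
def freqSq {d : ℕ} (n : Fin d → ℤ) : ℝ := ∑ j, (n j : ℝ) ^ 2

/-- The Sobolev weight `1 + |n|²`. -/
def weight {d : ℕ} (n : Fin d → ℤ) : ℝ := 1 + freqSq n

theorem freqSq_nonneg {d : ℕ} (n : Fin d → ℤ) : 0 ≤ freqSq n :=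
  Finset.sum_nonneg fun _ _ => sq_nonneg _

theorem weight_pos {d : ℕ} (n : Fin d → ℤ) : 0 < weight n := by
  have := freqSq_nonneg n
  unfold weight; linarith

/-- The periodic functions `u` with `∑ (1 + |n|²)² |û(n)|² < ∞`, as a subspace of `L²_♯(Y)`. -/
def H2Submodule (d : ℕ) : Submodule ℂ (L2 d) where
  carrier := {u | Memℓp (fun n => (weight n : ℂ) * (expBasis d).repr u n) 2}
  zero_mem' := by
    refine (congrArg (fun f => Memℓp f 2) ?_).mp (zero_memℓp : Memℓp (0 : (Fin d → ℤ) → ℂ) 2)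
    funext n
    simp
  add_mem' := by
    intro u v hu hv
    have h := Memℓp.add hu hv
    refine (congrArg (fun f => Memℓp f 2) ?_).mp h
    funext n
    simp [mul_add]
  smul_mem' := by
    intro c u hu
    have h := Memℓp.const_smul hu c
    refine (congrArg (fun f => Memℓp f 2) ?_).mp h
    funext n
    simp only [Pi.smul_apply, smul_eq_mul, map_smul, lp.coeFn_smul]
    ring

/-- The Sobolev space `H²_♯(Y)`. It is a type of its own, because its norm is the Sobolev norm and
not the one inherited from `L²_♯(Y)`. -/
def H2 (d : ℕ) : Type := H2Submodule d

namespace H2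

variable {d : ℕ}

instance : AddCommGroup (H2 d) := inferInstanceAs (AddCommGroup (H2Submodule d))
instance : Module ℂ (H2 d) := inferInstanceAs (Module ℂ (H2Submodule d))

/-- The inclusion of `H²_♯(Y)` in `L²_♯(Y)`. -/
def toL2 : H2 d →ₗ[ℂ] L2 d := (H2Submodule d).subtype

theorem toL2_injective : Function.Injective (toL2 (d := d)) := Subtype.val_injective

/-- The linear map `u ↦ ((1 + |n|²) û(n))_n` from `H²_♯(Y)` to `ℓ²(ℤ^d)`. -/
def weighted : H2 d →ₗ[ℂ] lp (fun _ : Fin d → ℤ => ℂ) 2 where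
  toFun u := ⟨fun n => (weight n : ℂ) * (expBasis d).repr (toL2 u) n, u.2⟩
  map_add' u v := by
    ext n
    simp only [map_add, lp.coeFn_add, Pi.add_apply, mul_add]
    try rfl
  map_smul' c u := by
    ext n
    simp only [map_smul, lp.coeFn_smul, Pi.smul_apply, smul_eq_mul, RingHom.id_apply]
    ring

theorem weighted_apply (u : H2 d) (n : Fin d → ℤ) :
    weighted u n = (weight n : ℂ) * (expBasis d).repr (toL2 u) n := rfl

theorem weighted_injective : Function.Injective (weighted (d := d)) := by
  intro u v h
  apply toL2_injective
  apply (expBasis d).repr.injective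
  ext n
  have hn : weighted u n = weighted v n := by rw [h]
  rw [weighted_apply, weighted_apply] at hn
  exact mul_left_cancel₀ (by exact_mod_cast (weight_pos n).ne') hn

instance : NormedAddCommGroup (H2 d) :=
  NormedAddCommGroup.induced (H2 d) (lp (fun _ : Fin d → ℤ => ℂ) 2) weighted weighted_injective

instance : InnerProductSpace ℂ (H2 d) := InnerProductSpace.induced weighted

/-- The norm of `H²_♯(Y)` is `(∑ (1 + |n|²)² |û(n)|²)^{1/2}`. -/
theorem hasSum_norm_sq (u : H2 d) :
    HasSum (fun n => weight n ^ 2 * ‖(expBasis d).repr (toL2 u) n‖ ^ 2) (‖u‖ ^ 2) := by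
  have h := lp.hasSum_norm (p := 2) (by norm_num) (weighted u)
  have hu : ‖weighted u‖ = ‖u‖ := rfl
  rw [hu] at h
  simpa [weighted_apply, mul_pow] using h

theorem memℓp_mul (u : H2 d) (m : (Fin d → ℤ) → ℂ) (hm : ∀ n, ‖m n‖ ≤ weight n) :
    Memℓp (fun n => m n * (expBasis d).repr (toL2 u) n) 2 := by
  have h2 : 0 < (2 : ℝ≥0∞).toReal := by norm_num
  have h := (memℓp_gen_iff h2).mp (lp.memℓp (weighted u))
  refine (memℓp_gen_iff h2).mpr (h.of_nonneg_of_le (fun n => by positivity) fun n => ?_)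
  refine Real.rpow_le_rpow (norm_nonneg _) ?_ h2.le
  rw [weighted_apply, norm_mul, norm_mul, Complex.norm_real, Real.norm_of_nonneg (weight_pos n).le]
  exact mul_le_mul_of_nonneg_right (hm n) (norm_nonneg _)

/-- The Fourier multiplier with symbol `m`: the function whose Fourier coefficients are
`m(n) û(n)`. -/
def multiplier (m : (Fin d → ℤ) → ℂ) (hm : ∀ n, ‖m n‖ ≤ weight n) : H2 d →ₗ[ℂ] L2 d where
  toFun u := (expBasis d).repr.symm ⟨fun n => m n * (expBasis d).repr (toL2 u) n, memℓp_mul u m hm⟩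
  map_add' u v := by
    rw [← map_add]
    congr 1
    ext n
    simp only [map_add, lp.coeFn_add, Pi.add_apply, mul_add]
    try rfl
  map_smul' c u := by
    rw [RingHom.id_apply, ← map_smul]
    congr 1
    ext n
    simp only [map_smul, lp.coeFn_smul, Pi.smul_apply, smul_eq_mul]
    ring

theorem repr_multiplier (m : (Fin d → ℤ) → ℂ) (hm : ∀ n, ‖m n‖ ≤ weight n) (u : H2 d)
    (n : Fin d → ℤ) :
    (expBasis d).repr (multiplier m hm u) n = m n * (expBasis d).repr (toL2 u) n := by
  simp [multiplier]

theorem norm_symbol_deriv_le (j : Fin d) (n : Fin d → ℤ) :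
    ‖Complex.I * (n j : ℂ)‖ ≤ weight n := by
  have h1 : (n j : ℝ) ^ 2 ≤ freqSq n :=
    Finset.single_le_sum (f := fun j => (n j : ℝ) ^ 2) (fun _ _ => sq_nonneg _) (Finset.mem_univ j)
  have h2 : |(n j : ℝ)| ^ 2 = (n j : ℝ) ^ 2 := sq_abs _
  rw [norm_mul, Complex.norm_I, one_mul, Complex.norm_intCast]
  unfold weight
  nlinarith [sq_nonneg (|(n j : ℝ)| - 1), abs_nonneg (n j : ℝ)]

theorem norm_symbol_laplacian_le (n : Fin d → ℤ) : ‖(-(freqSq n : ℝ) : ℂ)‖ ≤ weight n := by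
  rw [norm_neg, Complex.norm_real, Real.norm_of_nonneg (freqSq_nonneg n)]
  unfold weight
  linarith

/-- The partial derivative `∂u/∂y_j` of `u ∈ H²_♯(Y)` in the sense of periodic distributions; its
Fourier coefficients are `i n_j û(n)`. -/
def deriv (j : Fin d) : H2 d →ₗ[ℂ] L2 d :=
  multiplier (fun n => Complex.I * (n j : ℂ)) (norm_symbol_deriv_le j)

/-- The Laplacian `Δu` of `u ∈ H²_♯(Y)` in the sense of periodic distributions; its Fourier
coefficients are `-|n|² û(n)`. -/
def laplacian : H2 d →ₗ[ℂ] L2 d :=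
  multiplier (fun n => (-(freqSq n : ℝ) : ℂ)) norm_symbol_laplacian_le

/-- The `j`-th component `∂_j u + i η_j u` of the shifted gradient `(∇ + iη)u`. -/
def shiftedDeriv (η : EuclideanSpace ℝ (Fin d)) (j : Fin d) (u : H2 d) : L2 d :=
  deriv j u + (Complex.I * (η j : ℂ)) • toL2 u

/-- The shifted Laplacian `(∇ + iη)²u = Δu + 2i η·∇u - |η|² u`. -/
def shiftedLaplacian (η : EuclideanSpace ℝ (Fin d)) (u : H2 d) : L2 d :=
  laplacian u + (2 * Complex.I) • (∑ j, (η j : ℂ) • deriv j u) - ((‖η‖ ^ 2 : ℝ) : ℂ) • toL2 u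

end H2

/-! ### The Bloch eigenvalue problem -/

/-- The standing assumptions on the coefficient matrix `A`: its entries are real, bounded and
(Lebesgue) measurable functions on `ℝ^d`, and it is uniformly elliptic, `Y`-periodic and
symmetric. -/
structure IsCoefficientMatrix {d : ℕ} (A : (Fin d → ℝ) → Matrix (Fin d) (Fin d) ℝ) : Prop where
  measurable : ∀ j k, AEMeasurable (fun y => A y j k)
  bounded : ∃ M : ℝ, ∀ᵐ y, ∀ j k, |A y j k| ≤ M
  elliptic : ∃ α : ℝ, 0 < α ∧ ∀ᵐ y, ∀ ξ : Fin d → ℝ, α * (ξ ⬝ᵥ ξ) ≤ (A y).mulVec ξ ⬝ᵥ ξ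
  periodic : ∀ p : Fin d → ℤ, ∀ᵐ y, A (fun j => y j + 2 * π * p j) = A y
  symmetric : ∀ᵐ y, (A y).IsSymm

/-- The sesquilinear form
`a^ρ[η](u,v) = ∫_Y A(∇+iη)u · conj((∇+iη)v) dy + ρ² ∫_Y (∇+iη)²u conj((∇+iη)²v) dy`
on `H²_♯(Y)`, which is associated with the shifted operator
`A^ρ(η) = ρ²(∇+iη)⁴ - (∇+iη)·A(y)(∇+iη)`. -/
def blochForm {d : ℕ} (A : (Fin d → ℝ) → Matrix (Fin d) (Fin d) ℝ) (ρ : ℝ)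
    (η : EuclideanSpace ℝ (Fin d)) (u v : H2 d) : ℂ :=
  (∫ y, ∑ j, ∑ k, (A y j k : ℂ) * H2.shiftedDeriv η k u y * conj (H2.shiftedDeriv η j v y)
      ∂(cellMeasure d)) +
    (ρ : ℂ) ^ 2 *
      ∫ y, H2.shiftedLaplacian η u y * conj (H2.shiftedLaplacian η v y) ∂(cellMeasure d)

/-- `φ` is an eigenfunction of `A^ρ(η)` for the eigenvalue `l`: it is a nonzero element of
`H²_♯(Y)` and `A^ρ(η)φ = l φ`, that is, `a^ρ[η](φ,v) = l ∫_Y φ conj(v) dy` for all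
`v ∈ H²_♯(Y)`. The operator is self-adjoint, so that its eigenvalues are real. -/
def IsBlochEigenpair {d : ℕ} (A : (Fin d → ℝ) → Matrix (Fin d) (Fin d) ℝ) (ρ : ℝ)
    (η : EuclideanSpace ℝ (Fin d)) (l : ℝ) (φ : H2 d) : Prop :=
  φ ≠ 0 ∧ ∀ v : H2 d, blochForm A ρ η φ v =
    (l : ℂ) * ∫ y, H2.toL2 φ y * conj (H2.toL2 v y) ∂(cellMeasure d)

/-- The set of eigenvalues of `A^ρ(η)`, the Bloch eigenvalues at the dual parameter `η`. -/
def blochEigenvalues {d : ℕ} (A : (Fin d → ℝ) → Matrix (Fin d) (Fin d) ℝ) (ρ : ℝ)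
    (η : EuclideanSpace ℝ (Fin d)) : Set ℝ :=
  {l | ∃ φ : H2 d, IsBlochEigenpair A ρ η l φ}

/-- The first Bloch eigenvalue `λ_1^ρ(η)`, the smallest eigenvalue of `A^ρ(η)`. -/
def firstBlochEigenvalue {d : ℕ} (A : (Fin d → ℝ) → Matrix (Fin d) (Fin d) ℝ) (ρ : ℝ)
    (η : EuclideanSpace ℝ (Fin d)) : ℝ :=
  sInf (blochEigenvalues A ρ η)

end BlochWave

end

/-!
At `η = 0` the normalized constant function spans the kernel of the operator, and the fourth order
term makes the form coercive on `H²_♯(Y)` once the rank one form of the zeroth Fourier coefficient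
is added. This coercivity says that the linearization of the normalized eigenvalue equation is
invertible, so the implicit function theorem continues the eigenpair `(0, const)` analytically in
`η`. The form minus the continued eigenvalue, again with a rank one term added, stays positive
definite for small `η`. Testing it on an eigenfunction with another eigenvalue, which is orthogonal
to the continued one, shows that the continued eigenvalue is the smallest.
-/

noncomputable section

namespace BlochWave

open ContinuousLinearMap (adjoint)
open InnerProductSpace (rankOne)
open scoped ContDiff InnerProductSpace Topology

/-! ### Operators on complex Hilbert spaces -/

section Operators

variable {H K G : Type*} [NormedAddCommGroup H] [InnerProductSpace ℂ H]
  [NormedAddCommGroup K] [InnerProductSpace ℂ K] [NormedAddCommGroup G] [InnerProductSpace ℂ G]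

theorem isInvertible_restrictScalars_of_coercive [CompleteSpace H] {S : H →L[ℂ] H} {c : ℝ}
    (hc : 0 < c) (hS : ∀ u, c * ‖u‖ ^ 2 ≤ (⟪u, S u⟫_ℂ).re) :
    (S.restrictScalars ℝ).IsInvertible := by
  have hunit : IsUnit S :=
    S.isUnit_of_forall_le_norm_inner_map (c := ⟨c, hc.le⟩) hc fun u =>
      calc ‖u‖ ^ 2 * c = c * ‖u‖ ^ 2 := mul_comm _ _
        _ ≤ (⟪u, S u⟫_ℂ).re := hS u
        _ ≤ ‖⟪u, S u⟫_ℂ‖ := Complex.re_le_norm _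
        _ = ‖⟪S u, u⟫_ℂ‖ := norm_inner_symm _ _
  exact ⟨(ContinuousLinearEquiv.ofUnit hunit.unit).restrictScalars ℝ, rfl⟩

theorem eventually_re_inner_pos_of_coercive {X : Type*} [TopologicalSpace X] {S : X → H →L[ℂ] H}
    {x₀ : X} (hcont : ContinuousAt S x₀) {c : ℝ} (hc : 0 < c)
    (hS : ∀ u, c * ‖u‖ ^ 2 ≤ (⟪u, S x₀ u⟫_ℂ).re) :
    ∀ᶠ x in 𝓝 x₀, ∀ u ≠ 0, 0 < (⟪u, S x u⟫_ℂ).re := by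
  filter_upwards [hcont.eventually (Metric.ball_mem_nhds _ hc)] with x hx u hu
  have hdist : ‖S x₀ - S x‖ < c := by rwa [← dist_eq_norm, dist_comm]
  have hpos : 0 < ‖u‖ := norm_pos_iff.mpr hu
  have hperturb : (⟪u, (S x₀ - S x) u⟫_ℂ).re < c * ‖u‖ ^ 2 :=
    calc (⟪u, (S x₀ - S x) u⟫_ℂ).re ≤ ‖u‖ * ‖(S x₀ - S x) u‖ := re_inner_le_norm (𝕜 := ℂ) _ _
      _ ≤ ‖u‖ * (‖S x₀ - S x‖ * ‖u‖) := by gcongr; exact ContinuousLinearMap.le_opNorm _ _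
      _ = ‖S x₀ - S x‖ * ‖u‖ ^ 2 := by ring
      _ < c * ‖u‖ ^ 2 := mul_lt_mul_of_pos_right hdist (pow_pos hpos 2)
  rw [sub_apply, inner_sub_right, Complex.sub_re] at hperturb
  linarith [hS u]

theorem continuous_rankOne_self : Continuous fun w : H => rankOne ℂ w w :=
  (ContinuousLinearMap.smulRightL ℂ H H).continuous₂.comp
    ((innerSL ℂ).continuous.prodMk continuous_id)

variable {X : Type*} [NormedAddCommGroup X] [NormedSpace ℝ X] {n : ℕ∞ω} {x₀ : X}

theorem contDiffAt_clm_apply {f : X → H →L[ℂ] K} {g : X → H} (hf : ContDiffAt ℝ n f x₀)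
    (hg : ContDiffAt ℝ n g x₀) : ContDiffAt ℝ n (fun x => f x (g x)) x₀ :=
  ((ContinuousLinearMap.id ℂ (H →L[ℂ] K)).bilinearRestrictScalars
    ℝ).isBoundedBilinearMap.contDiff.contDiffAt.comp x₀ (hf.prodMk hg)

theorem contDiff_clm_comp {f : X → K →L[ℂ] G} {g : X → H →L[ℂ] K} (hf : ContDiff ℝ n f)
    (hg : ContDiff ℝ n g) : ContDiff ℝ n fun x => f x ∘L g x :=
  ((ContinuousLinearMap.compL ℂ H K G).bilinearRestrictScalars
    ℝ).isBoundedBilinearMap.contDiff.comp (hf.prodMk hg)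

theorem contDiff_smul_clm {a : X → ℂ} (ha : ContDiff ℝ n a) (L : H →L[ℂ] K) :
    ContDiff ℝ n fun x => a x • L :=
  ((ContinuousLinearMap.toSpanSingleton ℂ L).restrictScalars ℝ).contDiff.comp ha

theorem contDiff_adjoint [CompleteSpace H] [CompleteSpace K] :
    ContDiff ℝ n (adjoint : (H →L[ℂ] K) → K →L[ℂ] H) :=
  (AddMonoidHom.toRealLinearMap
    (adjoint (𝕜 := ℂ) (E := H) (F := K)).toLinearEquiv.toAddEquiv.toAddMonoidHom
    adjoint.continuous).contDiff

end Operators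

/-! ### Perturbation of a simple eigenvalue -/

section Perturbation

variable {H K : Type*} [NormedAddCommGroup H] [InnerProductSpace ℂ H]
  [NormedAddCommGroup K] [InnerProductSpace ℂ K]

/-- Eigenpairs of the variational eigenvalue problem `⟪v, T u⟫ = l ⟪ι v, ι u⟫` for all `v`: the
form `⟪·, T ·⟫` lives on `H`, whereas eigenfunctions are normalized in the larger space `K`. -/
def IsVariationalEigenpair (T : H →L[ℂ] H) (ι : H →L[ℂ] K) (l : ℝ) (u : H) : Prop :=
  u ≠ 0 ∧ ∀ v, ⟪v, T u⟫_ℂ = l * ⟪ι v, ι u⟫_ℂ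

theorem IsVariationalEigenpair.inner_eq_zero {T : H →L[ℂ] H} (hT : T.IsSymmetric) {ι : H →L[ℂ] K}
    {l μ : ℝ} {u v : H} (hu : IsVariationalEigenpair T ι l u)
    (hv : IsVariationalEigenpair T ι μ v) (hne : l ≠ μ) : ⟪ι u, ι v⟫_ℂ = 0 := by
  have hl : ⟪u, T v⟫_ℂ = l * ⟪ι u, ι v⟫_ℂ := by
    rw [← hT.apply_clm, ← inner_conj_symm, hu.2 v, map_mul, Complex.conj_ofReal, inner_conj_symm]
  have hmul : ((l : ℂ) - μ) * ⟪ι u, ι v⟫_ℂ = 0 := by rw [sub_mul, ← hl, hv.2 u, sub_self]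
  exact (mul_eq_zero.mp hmul).resolve_left (sub_ne_zero.mpr (mod_cast hne))

variable [CompleteSpace H] [CompleteSpace K]

/-- The operator on `H` representing the pulled back inner product `⟪ι ·, ι ·⟫`; it stands on the
right-hand side of a variational eigenvalue problem. -/
def massOp (ι : H →L[ℂ] K) : H →L[ℂ] H := adjoint ι ∘L ι

theorem inner_massOp_right (ι : H →L[ℂ] K) (u v : H) : ⟪v, massOp ι u⟫_ℂ = ⟪ι v, ι u⟫_ℂ :=
  ContinuousLinearMap.adjoint_inner_right ι v (ι u)

theorem inner_massOp_left (ι : H →L[ℂ] K) (u v : H) : ⟪massOp ι u, v⟫_ℂ = ⟪ι u, ι v⟫_ℂ :=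
  ContinuousLinearMap.adjoint_inner_left ι v (ι u)

/-- The operator `T - l ι*ι`, singular at an eigenpair `(l, w)` of `T`, with the rank one form
`⟪·, ι*ι w⟫ ⟪ι*ι w, ·⟫` added to lift the eigenvector `w` out of the kernel. -/
def borderedOp (T : H →L[ℂ] H) (ι : H →L[ℂ] K) (l : ℝ) (w : H) : H →L[ℂ] H :=
  T - (l : ℂ) • massOp ι + rankOne ℂ (massOp ι w) (massOp ι w)

theorem re_inner_borderedOp_self (T : H →L[ℂ] H) (ι : H →L[ℂ] K) (l : ℝ) (w u : H) :
    (⟪u, borderedOp T ι l w u⟫_ℂ).re =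
      (⟪u, T u⟫_ℂ).re - l * ‖ι u‖ ^ 2 + ‖⟪ι w, ι u⟫_ℂ‖ ^ 2 := by
  have hmass : (⟪u, massOp ι u⟫_ℂ).re = ‖ι u‖ ^ 2 := by
    rw [inner_massOp_right]; exact inner_self_eq_norm_sq (𝕜 := ℂ) (ι u)
  have hrank : (⟪u, rankOne ℂ (massOp ι w) (massOp ι w) u⟫_ℂ).re = ‖⟪ι w, ι u⟫_ℂ‖ ^ 2 := by
    rw [InnerProductSpace.rankOne_apply, inner_smul_right, inner_massOp_left, inner_massOp_right,
      ← inner_conj_symm (ι u), Complex.mul_conj, Complex.ofReal_re, Complex.normSq_eq_norm_sq]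
  rw [borderedOp, add_apply, sub_apply, smul_apply, inner_add_right, inner_sub_right,
    inner_smul_right, Complex.add_re, Complex.sub_re, Complex.re_ofReal_mul, hmass, hrank]

theorem IsVariationalEigenpair.le_of_borderedOp_pos {T : H →L[ℂ] H} (hT : T.IsSymmetric)
    {ι : H →L[ℂ] K} {l μ : ℝ} {w v : H} (hw : IsVariationalEigenpair T ι l w)
    (hpos : ∀ u ≠ 0, 0 < (⟪u, borderedOp T ι l w u⟫_ℂ).re)
    (hv : IsVariationalEigenpair T ι μ v) : l ≤ μ := by
  rcases eq_or_ne l μ with rfl | hne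
  · exact le_rfl
  have hself : (⟪v, T v⟫_ℂ).re = μ * ‖ι v‖ ^ 2 := by
    rw [hv.2 v, Complex.re_ofReal_mul]
    exact congrArg (μ * ·) (inner_self_eq_norm_sq (𝕜 := ℂ) (ι v))
  have hgap : 0 < (μ - l) * ‖ι v‖ ^ 2 := by
    have h := hpos v hv.1
    rw [re_inner_borderedOp_self, hw.inner_eq_zero hT hv hne, hself] at h
    simpa [sub_mul] using h
  exact (sub_pos.mp (pos_of_mul_pos_left hgap (sq_nonneg _))).le

/-- The residual `T u - l ι*ι u` of the eigenvalue problem with `l = ⟪e, T u⟫`, augmented by the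
defect `⟪ι e, ι u⟫ - 1` of the normalization in the direction of `ι*ι e`. The implicit function
theorem is applied to its zero set. -/
def eigenResidual (T : H →L[ℂ] H) (ι : H →L[ℂ] K) (e u : H) : H :=
  T u - ⟪e, T u⟫_ℂ • massOp ι u + (⟪ι e, ι u⟫_ℂ - 1) • massOp ι e

theorem eigenResidual_eq_borderedOp {T : H →L[ℂ] H} (hT : T.IsSymmetric) (ι : H →L[ℂ] K) {e : H}
    (he : T e = 0) (u : H) : eigenResidual T ι e u = borderedOp T ι 0 e u - massOp ι e := by
  have hker : ⟪e, T u⟫_ℂ = 0 := by rw [← hT.apply_clm, he, inner_zero_left]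
  simp [eigenResidual, borderedOp, hker, inner_massOp_left, sub_smul, add_sub_assoc]

theorem eigen_equation_of_eigenResidual_eq_zero {T : H →L[ℂ] H} {ι : H →L[ℂ] K} {e u : H}
    (he : ⟪ι e, ι e⟫_ℂ = 1) (hne : ⟪e, T u⟫_ℂ ≠ 1) (hu : eigenResidual T ι e u = 0) :
    ⟪ι e, ι u⟫_ℂ = 1 ∧ T u = ⟪e, T u⟫_ℂ • massOp ι u := by
  have hfactor : (⟪e, T u⟫_ℂ - 1) * (1 - ⟪ι e, ι u⟫_ℂ) = 0 := by
    have h : ⟪e, eigenResidual T ι e u⟫_ℂ = 0 := by rw [hu, inner_zero_right]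
    simp only [eigenResidual, inner_add_right, inner_sub_right, inner_smul_right,
      inner_massOp_right, he] at h
    linear_combination h
  have hnorm : ⟪ι e, ι u⟫_ℂ = 1 :=
    (sub_eq_zero.mp ((mul_eq_zero.mp hfactor).resolve_left (sub_ne_zero.mpr hne))).symm
  rw [eigenResidual, hnorm, sub_self, zero_smul, add_zero] at hu
  exact ⟨hnorm, sub_eq_zero.mp hu⟩

theorem isVariationalEigenpair_of_apply_eq_smul {T : H →L[ℂ] H} (hT : T.IsSymmetric)
    {ι : H →L[ℂ] K} {z : ℂ} {u : H} (hu : ι u ≠ 0) (h : T u = z • massOp ι u) :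
    IsVariationalEigenpair T ι z.re u := by
  have hinner : ∀ v, ⟪v, T u⟫_ℂ = z * ⟪ι v, ι u⟫_ℂ := fun v => by
    rw [h, inner_smul_right, inner_massOp_right]
  have hreal : conj z = z := by
    refine mul_right_cancel₀ (inner_self_ne_zero.mpr hu) ?_
    rw [← hinner, ← hT.apply_clm, ← inner_conj_symm (T u), hinner, map_mul, inner_conj_symm]
  exact ⟨fun h0 => hu (by rw [h0, map_zero]), fun v => by
    rw [hinner, Complex.conj_eq_iff_re.mp hreal]⟩

variable {E : Type*} [NormedAddCommGroup E] [NormedSpace ℝ E] {n : ℕ∞ω}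
  {T : E → H →L[ℂ] H} {x₀ : E} {ι : H →L[ℂ] K} {e : H}

theorem contDiffAt_eigenResidual (hT : ContDiffAt ℝ n T x₀) (ι : H →L[ℂ] K) (e : H) :
    ContDiffAt ℝ n (fun p : E × H => eigenResidual (T p.1) ι e p.2) (x₀, e) := by
  have hTu : ContDiffAt ℝ n (fun p : E × H => T p.1 p.2) (x₀, e) :=
    contDiffAt_clm_apply (hT.comp (x₀, e) contDiffAt_fst) contDiffAt_snd
  have hmass : ContDiffAt ℝ n (fun p : E × H => massOp ι p.2) (x₀, e) :=
    contDiffAt_clm_apply contDiffAt_const contDiffAt_snd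
  have hι : ContDiffAt ℝ n (fun p : E × H => ι p.2) (x₀, e) :=
    contDiffAt_clm_apply contDiffAt_const contDiffAt_snd
  exact (hTu.sub ((contDiffAt_const.inner ℂ hTu).smul hmass)).add
    (((contDiffAt_const.inner ℂ hι).sub contDiffAt_const).smul contDiffAt_const)

theorem fderiv_eigenResidual_comp_inr (hn : n ≠ 0) (hT : ContDiffAt ℝ n T x₀)
    (hsymm : (T x₀).IsSymmetric) (he : T x₀ e = 0) :
    fderiv ℝ (fun p : E × H => eigenResidual (T p.1) ι e p.2) (x₀, e) ∘L .inr ℝ E H =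
      (borderedOp (T x₀) ι 0 e).restrictScalars ℝ := by
  have hpartial := ((contDiffAt_eigenResidual hT ι e).differentiableAt hn).hasFDerivAt.comp e
    (hasFDerivAt_prodMk_right x₀ e)
  have haffine : HasFDerivAt (eigenResidual (T x₀) ι e)
      ((borderedOp (T x₀) ι 0 e).restrictScalars ℝ) e := by
    rw [funext (eigenResidual_eq_borderedOp hsymm ι he)]
    exact ((borderedOp (T x₀) ι 0 e).restrictScalars ℝ).hasFDerivAt.sub_const (massOp ι e)
  exact hpartial.unique haffine

theorem exists_contDiffAt_eigenpair [CompleteSpace E] (hn : n ≠ 0) (hT : ContDiffAt ℝ n T x₀)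
    (hsymm : ∀ x, (T x).IsSymmetric) (he : T x₀ e = 0) (hnorm : ⟪ι e, ι e⟫_ℂ = 1) {c : ℝ}
    (hc : 0 < c) (hcoer : ∀ u, c * ‖u‖ ^ 2 ≤ (⟪u, borderedOp (T x₀) ι 0 e u⟫_ℂ).re) :
    ∃ (l : E → ℝ) (φ : E → H), ContDiffAt ℝ n l x₀ ∧ ContDiffAt ℝ n φ x₀ ∧ l x₀ = 0 ∧
      φ x₀ = e ∧ ∀ᶠ x in 𝓝 x₀, IsVariationalEigenpair (T x) ι (l x) (φ x) := by
  have hF := contDiffAt_eigenResidual hT ι e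
  have hinv : (fderiv ℝ (fun p : E × H => eigenResidual (T p.1) ι e p.2) (x₀, e) ∘L
      .inr ℝ E H).IsInvertible := by
    rw [fderiv_eigenResidual_comp_inr hn hT (hsymm x₀) he]
    exact isInvertible_restrictScalars_of_coercive hc hcoer
  have hF₀ : eigenResidual (T x₀) ι e e = 0 := by
    rw [eigenResidual, he, hnorm, inner_zero_right, zero_smul, sub_self, sub_self, zero_smul,
      add_zero]
  set φ := hF.implicitFunction hn hinv
  have hφ : ContDiffAt ℝ n φ x₀ := hF.contDiffAt_implicitFunction hn hinv
  have hφ₀ : φ x₀ = e := hF.implicitFunction_apply_self hn hinv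
  have hl : ContDiffAt ℝ n (fun x => ⟪e, T x (φ x)⟫_ℂ) x₀ :=
    contDiffAt_const.inner ℂ (contDiffAt_clm_apply hT hφ)
  have hl₀ : ⟪e, T x₀ (φ x₀)⟫_ℂ = 0 := by rw [hφ₀, he, inner_zero_right]
  refine ⟨fun x => (⟪e, T x (φ x)⟫_ℂ).re, φ, Complex.reCLM.contDiff.contDiffAt.comp x₀ hl, hφ,
    congrArg Complex.re hl₀, hφ₀, ?_⟩
  filter_upwards [hF.eventually_apply_implicitFunction hn hinv,
    hl.continuousAt.eventually_ne (hl₀.trans_ne zero_ne_one)] with x hx hne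
  obtain ⟨hone, heq⟩ := eigen_equation_of_eigenResidual_eq_zero hnorm hne (hx.trans hF₀)
  refine isVariationalEigenpair_of_apply_eq_smul (hsymm x) (fun h0 => ?_) heq
  rw [h0, inner_zero_right] at hone
  exact zero_ne_one hone

theorem exists_contDiffAt_least_eigenpair [CompleteSpace E] (hn : n ≠ 0)
    (hT : ContDiffAt ℝ n T x₀) (hsymm : ∀ x, (T x).IsSymmetric) (he : T x₀ e = 0)
    (hnorm : ⟪ι e, ι e⟫_ℂ = 1) {c : ℝ} (hc : 0 < c)
    (hcoer : ∀ u, c * ‖u‖ ^ 2 ≤ (⟪u, T x₀ u⟫_ℂ).re + ‖⟪ι e, ι u⟫_ℂ‖ ^ 2) :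
    ∃ (l : E → ℝ) (φ : E → H), ContDiffAt ℝ n l x₀ ∧ ContDiffAt ℝ n φ x₀ ∧
      ∀ᶠ x in 𝓝 x₀, IsVariationalEigenpair (T x) ι (l x) (φ x) ∧
        ∀ μ ψ, IsVariationalEigenpair (T x) ι μ ψ → l x ≤ μ := by
  have hcoer₀ : ∀ u, c * ‖u‖ ^ 2 ≤ (⟪u, borderedOp (T x₀) ι 0 e u⟫_ℂ).re := fun u => by
    rw [re_inner_borderedOp_self, zero_mul, sub_zero]
    exact hcoer u
  obtain ⟨l, φ, hl, hφ, hl₀, hφ₀, hpair⟩ :=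
    exists_contDiffAt_eigenpair hn hT hsymm he hnorm hc hcoer₀
  have hmass : ContinuousAt (fun x => massOp ι (φ x)) x₀ :=
    (massOp ι).continuous.continuousAt.comp hφ.continuousAt
  have hcont : ContinuousAt (fun x => borderedOp (T x) ι (l x) (φ x)) x₀ := by
    have hlC : ContinuousAt (fun x => (l x : ℂ)) x₀ :=
      Complex.continuous_ofReal.continuousAt.comp hl.continuousAt
    have hrank : ContinuousAt (fun x => rankOne ℂ (massOp ι (φ x)) (massOp ι (φ x))) x₀ :=
      continuous_rankOne_self.continuousAt.comp hmass
    exact (hT.continuousAt.sub (hlC.smul continuousAt_const)).add hrank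
  have hpos := eventually_re_inner_pos_of_coercive hcont hc fun u => by
    rw [hl₀, hφ₀]; exact hcoer₀ u
  refine ⟨l, φ, hl, hφ, ?_⟩
  filter_upwards [hpair, hpos] with x hx hx_pos
  exact ⟨hx, fun μ ψ hψ => hx.le_of_borderedOp_pos (hsymm x) hx_pos hψ⟩

end Perturbation

/-! ### Fourier multipliers on `H²_♯(Y)` -/

section Fourier

variable {d : ℕ}

theorem inner_L2_eq_integral (u v : L2 d) :
    ⟪v, u⟫_ℂ = ∫ y, u y * conj (v y) ∂(cellMeasure d) := by
  simp only [L2.inner_def, RCLike.inner_apply]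

theorem hasSum_norm_sq_repr (u : L2 d) :
    HasSum (fun n => ‖(expBasis d).repr u n‖ ^ 2) (‖u‖ ^ 2) := by
  simpa using lp.hasSum_norm (p := 2) (by norm_num) ((expBasis d).repr u)

theorem expBasis_repr_expL2 (m n : Fin d → ℤ) :
    (expBasis d).repr (expL2 m) n = if n = m then 1 else 0 := by
  rw [HilbertBasis.repr_apply_apply, coe_expBasis]
  exact orthonormal_iff_ite.mp (orthonormal_expL2 d) n m

theorem eq_zero_of_repr_eq_zero {u : L2 d} (h : ∀ n, (expBasis d).repr u n = 0) : u = 0 :=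
  (expBasis d).repr.map_eq_zero_iff.mp (lp.ext (funext h))

theorem one_le_freqSq {n : Fin d → ℤ} (hn : n ≠ 0) : 1 ≤ freqSq n := by
  obtain ⟨j, hj⟩ := Function.ne_iff.mp hn
  calc (1 : ℝ) ≤ (n j : ℝ) ^ 2 := by exact_mod_cast sq_pos_of_ne_zero hj
    _ ≤ freqSq n := Finset.single_le_sum (f := fun j => (n j : ℝ) ^ 2)
        (fun _ _ => sq_nonneg _) (Finset.mem_univ j)

theorem one_le_weight (n : Fin d → ℤ) : 1 ≤ weight n := le_add_of_nonneg_right (freqSq_nonneg n)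

end Fourier

namespace H2

variable {d : ℕ}

theorem weighted_surjective : Function.Surjective (weighted (d := d)) := by
  intro f
  have hmem : Memℓp (fun n => (weight n : ℂ)⁻¹ * f n) 2 := (lp.memℓp f).mono' fun n => by
    rw [norm_mul, norm_inv, Complex.norm_of_nonneg (weight_pos n).le]
    exact mul_le_of_le_one_left (norm_nonneg _) (inv_le_one_of_one_le₀ (one_le_weight n))
  have hcancel : ∀ n, (weight n : ℂ) *
      (expBasis d).repr ((expBasis d).repr.symm ⟨_, hmem⟩) n = f n := fun n => by
    rw [LinearIsometryEquiv.apply_symm_apply]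
    exact mul_inv_cancel_left₀ (by exact_mod_cast (weight_pos n).ne') _
  have hH2 : (expBasis d).repr.symm ⟨_, hmem⟩ ∈ H2Submodule d := by
    change Memℓp (fun n => (weight n : ℂ) * _) 2
    simp only [hcancel]
    exact lp.memℓp f
  exact ⟨(⟨_, hH2⟩ : H2Submodule d), lp.ext (funext hcancel)⟩

instance : CompleteSpace (H2 d) :=
  ((AddMonoidHomClass.isometry_of_norm (weighted (d := d))
    fun _ => rfl).isUniformInducing.completeSpace_congr weighted_surjective).mpr inferInstance

theorem norm_le_of_norm_repr_le {v : L2 d} {u : H2 d}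
    (h : ∀ n, ‖(expBasis d).repr v n‖ ≤ weight n * ‖(expBasis d).repr (toL2 u) n‖) :
    ‖v‖ ≤ ‖u‖ := by
  refine le_of_sq_le_sq (hasSum_le (fun n => ?_) (hasSum_norm_sq_repr v) (hasSum_norm_sq u))
    (norm_nonneg _)
  rw [← mul_pow]
  exact pow_le_pow_left₀ (norm_nonneg _) (h n) 2

theorem norm_toL2_le (u : H2 d) : ‖toL2 u‖ ≤ ‖u‖ :=
  norm_le_of_norm_repr_le fun n => le_mul_of_one_le_left (norm_nonneg _) (one_le_weight n)

theorem norm_multiplier_le (m : (Fin d → ℤ) → ℂ) (hm : ∀ n, ‖m n‖ ≤ weight n) (u : H2 d) :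
    ‖multiplier m hm u‖ ≤ ‖u‖ :=
  norm_le_of_norm_repr_le fun n => by
    rw [repr_multiplier, norm_mul]
    exact mul_le_mul_of_nonneg_right (hm n) (norm_nonneg _)

/-- The inclusion `toL2` as a bounded operator. -/
def toL2CLM : H2 d →L[ℂ] L2 d :=
  toL2.mkContinuous 1 fun u => (norm_toL2_le u).trans_eq (one_mul _).symm

/-- The partial derivative `deriv` as a bounded operator. -/
def derivCLM (j : Fin d) : H2 d →L[ℂ] L2 d :=
  (deriv j).mkContinuous 1 fun u => (norm_multiplier_le _ _ u).trans_eq (one_mul _).symm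

/-- The Laplacian `laplacian` as a bounded operator. -/
def laplacianCLM : H2 d →L[ℂ] L2 d :=
  laplacian.mkContinuous 1 fun u => (norm_multiplier_le _ _ u).trans_eq (one_mul _).symm

/-- The component `shiftedDeriv` of `∇ + iη` as a bounded operator. -/
def shiftedDerivCLM (η : EuclideanSpace ℝ (Fin d)) (j : Fin d) : H2 d →L[ℂ] L2 d :=
  derivCLM j + (Complex.I * (η j : ℂ)) • toL2CLM

/-- The shifted Laplacian `shiftedLaplacian` as a bounded operator. -/
def shiftedLaplacianCLM (η : EuclideanSpace ℝ (Fin d)) : H2 d →L[ℂ] L2 d :=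
  laplacianCLM + (2 * Complex.I) • (∑ j, (η j : ℂ) • derivCLM j)
    - ((‖η‖ ^ 2 : ℝ) : ℂ) • toL2CLM

theorem toL2CLM_apply (u : H2 d) : toL2CLM u = toL2 u := rfl

theorem shiftedDerivCLM_apply (η : EuclideanSpace ℝ (Fin d)) (j : Fin d) (u : H2 d) :
    shiftedDerivCLM η j u = shiftedDeriv η j u := rfl

theorem shiftedLaplacianCLM_apply (η : EuclideanSpace ℝ (Fin d)) (u : H2 d) :
    shiftedLaplacianCLM η u = shiftedLaplacian η u := by
  rw [shiftedLaplacianCLM, sub_apply, add_apply, smul_apply, smul_apply, sum_apply]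
  rfl

theorem contDiff_ofReal_coord (j : Fin d) :
    ContDiff ℝ ω fun η : EuclideanSpace ℝ (Fin d) => (η j : ℂ) :=
  Complex.ofRealCLM.contDiff.comp (EuclideanSpace.proj (𝕜 := ℝ) j).contDiff

theorem contDiff_shiftedDerivCLM (j : Fin d) :
    ContDiff ℝ ω fun η => shiftedDerivCLM (d := d) η j :=
  contDiff_const.add (contDiff_smul_clm (contDiff_const.mul (contDiff_ofReal_coord j)) _)

theorem contDiff_shiftedLaplacianCLM : ContDiff ℝ ω (shiftedLaplacianCLM (d := d)) := by
  have hgrad : ContDiff ℝ ω fun η : EuclideanSpace ℝ (Fin d) => ∑ j, (η j : ℂ) • derivCLM j :=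
    ContDiff.sum fun j _ => contDiff_smul_clm (contDiff_ofReal_coord j) _
  have hnorm : ContDiff ℝ ω fun η : EuclideanSpace ℝ (Fin d) => ((‖η‖ ^ 2 : ℝ) : ℂ) :=
    Complex.ofRealCLM.contDiff.comp (contDiff_norm_sq ℝ)
  exact (contDiff_const.add (hgrad.const_smul (2 * Complex.I))).sub (contDiff_smul_clm hnorm _)

theorem shiftedLaplacian_zero (u : H2 d) : shiftedLaplacian 0 u = laplacian u := by
  simp [shiftedLaplacian]

theorem repr_laplacian (u : H2 d) (n : Fin d → ℤ) :
    (expBasis d).repr (laplacian u) n = -(freqSq n : ℂ) * (expBasis d).repr (toL2 u) n :=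
  repr_multiplier _ _ u n

/-- Off the zero frequency `(1 + |n|²)² ≤ 4 |n|⁴`. -/
theorem norm_sq_le_laplacian (u : H2 d) :
    ‖u‖ ^ 2 ≤ 4 * ‖laplacian u‖ ^ 2 + ‖(expBasis d).repr (toL2 u) 0‖ ^ 2 := by
  refine hasSum_le (fun n => ?_) (hasSum_norm_sq u)
    (((hasSum_norm_sq_repr (laplacian u)).mul_left 4).add
      (hasSum_ite_eq (0 : Fin d → ℤ) (‖(expBasis d).repr (toL2 u) 0‖ ^ 2)))
  rw [repr_laplacian, norm_mul, norm_neg, Complex.norm_of_nonneg (freqSq_nonneg n)]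
  split_ifs with hn
  · simp [hn, weight, freqSq]
  · have hweight : weight n ≤ 2 * freqSq n := by unfold weight; linarith [one_le_freqSq hn]
    calc weight n ^ 2 * ‖(expBasis d).repr (toL2 u) n‖ ^ 2
        ≤ (2 * freqSq n) ^ 2 * ‖(expBasis d).repr (toL2 u) n‖ ^ 2 := by
          gcongr; exact (weight_pos n).le
      _ = 4 * (freqSq n * ‖(expBasis d).repr (toL2 u) n‖) ^ 2 + 0 := by ring

/-- The normalized constant function as an element of `H²_♯(Y)`. It spans the kernel of the
periodic operator at `η = 0`. -/
def const (d : ℕ) : H2 d :=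
  (⟨expL2 0, by
    refine (lp.memℓp ((expBasis d).repr (expL2 0))).mono' fun n => ?_
    rw [expBasis_repr_expL2]
    split_ifs with h
    · simp [h, weight, freqSq]
    · simp⟩ : H2Submodule d)

theorem toL2_const : toL2 (const d) = expL2 0 := rfl

theorem inner_const_left (u : L2 d) : ⟪toL2 (const d), u⟫_ℂ = (expBasis d).repr u 0 := by
  rw [HilbertBasis.repr_apply_apply, coe_expBasis, toL2_const]

theorem multiplier_const {m : (Fin d → ℤ) → ℂ} (hm : ∀ n, ‖m n‖ ≤ weight n) (h0 : m 0 = 0) :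
    multiplier m hm (const d) = 0 := by
  refine eq_zero_of_repr_eq_zero fun n => ?_
  rw [repr_multiplier, toL2_const, expBasis_repr_expL2]
  split_ifs with hn
  · rw [hn, h0, zero_mul]
  · rw [mul_zero]

theorem shiftedDeriv_zero_const (j : Fin d) : shiftedDeriv 0 j (const d) = 0 := by
  have hderiv : deriv j (const d) = 0 := multiplier_const _ (by simp)
  simp [shiftedDeriv, hderiv]

theorem shiftedLaplacian_zero_const : shiftedLaplacian 0 (const d) = 0 := by
  rw [shiftedLaplacian_zero]
  exact multiplier_const _ (by simp [freqSq])

end H2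

/-! ### The Bloch operator -/

section Multiplication

variable {α : Type*} [MeasurableSpace α] {μ : Measure α} {a : α → ℝ}

/-- Multiplication by the bounded real function `a` on `L²(μ)`. -/
def mulCLM (ha : MemLp a ∞ μ) : Lp ℂ 2 μ →L[ℂ] Lp ℂ 2 μ :=
  (ContinuousLinearMap.mul ℂ ℂ).holderL μ ∞ 2 2 (ha.ofReal (K := ℂ)).toLp

theorem inner_mulCLM_ae (ha : MemLp a ∞ μ) (f g : Lp ℂ 2 μ) :
    (fun y => ⟪g y, mulCLM ha f y⟫_ℂ) =ᵐ[μ] fun y => (a y : ℂ) * f y * conj (g y) := by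
  filter_upwards [(ContinuousLinearMap.mul ℂ ℂ).coeFn_holder (r := 2) (ha.ofReal (K := ℂ)).toLp f,
    (ha.ofReal (K := ℂ)).coeFn_toLp] with y hmul hcoe
  rw [RCLike.inner_apply]
  exact congrArg (· * conj (g y)) (hmul.trans (congrArg (· * f y) hcoe))

theorem integrable_mul_mul_conj (ha : MemLp a ∞ μ) (f g : Lp ℂ 2 μ) :
    Integrable (fun y => (a y : ℂ) * f y * conj (g y)) μ :=
  (L2.integrable_inner g (mulCLM ha f)).congr (inner_mulCLM_ae ha f g)

theorem inner_mulCLM (ha : MemLp a ∞ μ) (f g : Lp ℂ 2 μ) :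
    ⟪g, mulCLM ha f⟫_ℂ = ∫ y, (a y : ℂ) * f y * conj (g y) ∂μ :=
  integral_congr_ae (inner_mulCLM_ae ha f g)

end Multiplication

theorem re_sum_mul_conj_nonneg {ι : Type*} [Fintype ι] {M : Matrix ι ι ℝ} (hM : M.PosSemidef)
    (z : ι → ℂ) : 0 ≤ (∑ j, ∑ k, (M j k : ℂ) * z k * conj (z j)).re := by
  have hsplit : (∑ j, ∑ k, (M j k : ℂ) * z k * conj (z j)).re =
      (fun j => (z j).re) ⬝ᵥ M.mulVec (fun k => (z k).re) +
        (fun j => (z j).im) ⬝ᵥ M.mulVec (fun k => (z k).im) := by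
    simp only [Matrix.mulVec, dotProduct, Complex.re_sum, Finset.mul_sum, ← Finset.sum_add_distrib]
    refine Finset.sum_congr rfl fun j _ => Finset.sum_congr rfl fun k _ => ?_
    simp only [Complex.mul_re, Complex.mul_im, Complex.ofReal_re, Complex.ofReal_im,
      Complex.conj_re, Complex.conj_im]
    ring
  rw [hsplit]
  exact add_nonneg (hM.dotProduct_mulVec_nonneg _) (hM.dotProduct_mulVec_nonneg _)

section BlochForm

variable {d : ℕ} {A : (Fin d → ℝ) → Matrix (Fin d) (Fin d) ℝ}

theorem conj_blochForm (hsymm : ∀ᵐ y ∂cellMeasure d, (A y).IsSymm) (ρ : ℝ)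
    (η : EuclideanSpace ℝ (Fin d)) (u v : H2 d) :
    conj (blochForm A ρ η u v) = blochForm A ρ η v u := by
  rw [blochForm, blochForm, map_add, map_mul, map_pow, Complex.conj_ofReal, ← integral_conj,
    ← integral_conj]
  congr 1
  · refine integral_congr_ae ?_
    filter_upwards [hsymm] with y hy
    simp only [map_sum, map_mul, Complex.conj_conj, Complex.conj_ofReal]
    rw [Finset.sum_comm]
    refine Finset.sum_congr rfl fun k _ => Finset.sum_congr rfl fun j _ => ?_
    rw [hy.apply k j]
    ring
  · simp only [map_mul, Complex.conj_conj, mul_comm]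

theorem le_re_blochForm_self (hA : ∀ j k, MemLp (fun y => A y j k) ∞ (cellMeasure d))
    (hpos : ∀ᵐ y ∂cellMeasure d, (A y).PosSemidef) (ρ : ℝ) (η : EuclideanSpace ℝ (Fin d))
    (u : H2 d) : ρ ^ 2 * ‖H2.shiftedLaplacian η u‖ ^ 2 ≤ (blochForm A ρ η u u).re := by
  have hsecond : 0 ≤ (∫ y, ∑ j, ∑ k, (A y j k : ℂ) * H2.shiftedDeriv η k u y *
      conj (H2.shiftedDeriv η j u y) ∂cellMeasure d).re := by
    have hint := integrable_finsetSum Finset.univ fun j _ =>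
      integrable_finsetSum Finset.univ fun k _ =>
        integrable_mul_mul_conj (hA j k) (H2.shiftedDeriv η k u) (H2.shiftedDeriv η j u)
    refine (integral_nonneg_of_ae ?_).trans_eq (integral_re (𝕜 := ℂ) hint)
    filter_upwards [hpos] with y hy
    exact re_sum_mul_conj_nonneg hy fun k => H2.shiftedDeriv η k u y
  have hfourth : ((ρ : ℂ) ^ 2 * ∫ y, H2.shiftedLaplacian η u y *
      conj (H2.shiftedLaplacian η u y) ∂cellMeasure d).re =
      ρ ^ 2 * ‖H2.shiftedLaplacian η u‖ ^ 2 := by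
    rw [← inner_L2_eq_integral, ← Complex.ofReal_pow, Complex.re_ofReal_mul]
    exact congrArg (ρ ^ 2 * ·) (inner_self_eq_norm_sq (𝕜 := ℂ) _)
  rw [blochForm, Complex.add_re, hfourth]
  exact le_add_of_nonneg_left hsecond

end BlochForm

section BlochOp

variable {d : ℕ} {A : (Fin d → ℝ) → Matrix (Fin d) (Fin d) ℝ}
  (hA : ∀ j k, MemLp (fun y => A y j k) ∞ (cellMeasure d))

/-- The operator on `H²_♯(Y)` that represents the Bloch form through the inner product of
`H²_♯(Y)`. -/
def blochOp (ρ : ℝ) (η : EuclideanSpace ℝ (Fin d)) : H2 d →L[ℂ] H2 d :=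
  (∑ j, ∑ k, adjoint (H2.shiftedDerivCLM η j) ∘L mulCLM (hA j k) ∘L H2.shiftedDerivCLM η k) +
    (ρ : ℂ) ^ 2 • (adjoint (H2.shiftedLaplacianCLM η) ∘L H2.shiftedLaplacianCLM η)

theorem blochOp_apply (ρ : ℝ) (η : EuclideanSpace ℝ (Fin d)) (u : H2 d) :
    blochOp hA ρ η u =
      (∑ j, ∑ k, adjoint (H2.shiftedDerivCLM η j) (mulCLM (hA j k) (H2.shiftedDeriv η k u))) +
        (ρ : ℂ) ^ 2 • adjoint (H2.shiftedLaplacianCLM η) (H2.shiftedLaplacian η u) := by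
  simp only [blochOp, add_apply, sum_apply, smul_apply, ContinuousLinearMap.comp_apply,
    H2.shiftedDerivCLM_apply, H2.shiftedLaplacianCLM_apply]

theorem inner_blochOp (ρ : ℝ) (η : EuclideanSpace ℝ (Fin d)) (u v : H2 d) :
    ⟪v, blochOp hA ρ η u⟫_ℂ = blochForm A ρ η u v := by
  have hint : ∀ j k, Integrable (fun y => (A y j k : ℂ) * H2.shiftedDeriv η k u y *
      conj (H2.shiftedDeriv η j v y)) (cellMeasure d) :=
    fun j k => integrable_mul_mul_conj (hA j k) _ _
  rw [blochForm, integral_finsetSum _ fun j _ => integrable_finsetSum _ fun k _ => hint j k]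
  simp only [integral_finsetSum _ fun k _ => hint _ k, ← inner_L2_eq_integral,
    ← inner_mulCLM (hA _ _), blochOp_apply, inner_add_right, inner_sum, inner_smul_right,
    ContinuousLinearMap.adjoint_inner_right, H2.shiftedDerivCLM_apply,
    H2.shiftedLaplacianCLM_apply]

theorem isSymmetric_blochOp (hsymm : ∀ᵐ y ∂cellMeasure d, (A y).IsSymm) (ρ : ℝ)
    (η : EuclideanSpace ℝ (Fin d)) : (blochOp hA ρ η).IsSymmetric := fun u v => by
  change ⟪blochOp hA ρ η u, v⟫_ℂ = ⟪u, blochOp hA ρ η v⟫_ℂ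
  rw [← inner_conj_symm, inner_blochOp, inner_blochOp, conj_blochForm hsymm]

theorem coercive_blochOp_zero (hpos : ∀ᵐ y ∂cellMeasure d, (A y).PosSemidef) (ρ : ℝ) (u : H2 d) :
    min (ρ ^ 2 / 4) 1 * ‖u‖ ^ 2 ≤ (⟪u, blochOp hA ρ 0 u⟫_ℂ).re +
      ‖⟪H2.toL2CLM (H2.const d), H2.toL2CLM u⟫_ℂ‖ ^ 2 := by
  rw [inner_blochOp, H2.toL2CLM_apply, H2.toL2CLM_apply, H2.inner_const_left]
  have hform := le_re_blochForm_self hA hpos ρ 0 u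
  rw [H2.shiftedLaplacian_zero] at hform
  have hmin : 0 ≤ min (ρ ^ 2 / 4) 1 := by positivity
  calc min (ρ ^ 2 / 4) 1 * ‖u‖ ^ 2
      ≤ min (ρ ^ 2 / 4) 1 * (4 * ‖H2.laplacian u‖ ^ 2) +
        min (ρ ^ 2 / 4) 1 * ‖(expBasis d).repr (H2.toL2 u) 0‖ ^ 2 := by
        rw [← mul_add]; exact mul_le_mul_of_nonneg_left (H2.norm_sq_le_laplacian u) hmin
    _ ≤ ρ ^ 2 / 4 * (4 * ‖H2.laplacian u‖ ^ 2) +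
        1 * ‖(expBasis d).repr (H2.toL2 u) 0‖ ^ 2 := by
        gcongr
        · exact min_le_left _ _
        · exact min_le_right _ _
    _ ≤ (blochForm A ρ 0 u u).re + ‖(expBasis d).repr (H2.toL2 u) 0‖ ^ 2 := by linarith

theorem contDiff_blochOp (ρ : ℝ) : ContDiff ℝ ω (blochOp hA ρ) := by
  have hsecond : ∀ j k, ContDiff ℝ ω fun η =>
      adjoint (H2.shiftedDerivCLM η j) ∘L mulCLM (hA j k) ∘L H2.shiftedDerivCLM η k := fun j k =>
    contDiff_clm_comp (contDiff_adjoint.comp (H2.contDiff_shiftedDerivCLM j))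
      (contDiff_clm_comp contDiff_const (H2.contDiff_shiftedDerivCLM k))
  have hfourth : ContDiff ℝ ω fun η =>
      adjoint (H2.shiftedLaplacianCLM (d := d) η) ∘L H2.shiftedLaplacianCLM η :=
    contDiff_clm_comp (contDiff_adjoint.comp H2.contDiff_shiftedLaplacianCLM)
      H2.contDiff_shiftedLaplacianCLM
  exact (ContDiff.sum fun j _ => ContDiff.sum fun k _ => hsecond j k).add
    (hfourth.const_smul ((ρ : ℂ) ^ 2))

theorem blochOp_zero_const (ρ : ℝ) : blochOp hA ρ 0 (H2.const d) = 0 := by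
  simp [blochOp_apply, H2.shiftedDeriv_zero_const, H2.shiftedLaplacian_zero_const]

theorem isVariationalEigenpair_blochOp_iff {ρ : ℝ} {η : EuclideanSpace ℝ (Fin d)} {l : ℝ}
    {φ : H2 d} :
    IsVariationalEigenpair (blochOp hA ρ η) H2.toL2CLM l φ ↔ IsBlochEigenpair A ρ η l φ := by
  simp only [IsVariationalEigenpair, IsBlochEigenpair, inner_blochOp, H2.toL2CLM_apply,
    inner_L2_eq_integral]

end BlochOp

section FirstEigenvalue

variable {d : ℕ} {A : (Fin d → ℝ) → Matrix (Fin d) (Fin d) ℝ}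

theorem exists_analyticAt_firstBlochEigenpair
    (hA : ∀ j k, MemLp (fun y => A y j k) ∞ (cellMeasure d))
    (hpos : ∀ᵐ y ∂cellMeasure d, (A y).PosSemidef) {ρ : ℝ} (hρ : ρ ≠ 0) :
    ∃ φ : EuclideanSpace ℝ (Fin d) → H2 d,
      AnalyticAt ℝ (firstBlochEigenvalue A ρ) 0 ∧ AnalyticAt ℝ φ 0 ∧ ∀ᶠ η in 𝓝 0,
        IsLeast (blochEigenvalues A ρ η) (firstBlochEigenvalue A ρ η) ∧
          IsBlochEigenpair A ρ η (firstBlochEigenvalue A ρ η) (φ η) := by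
  have hsymm : ∀ᵐ y ∂cellMeasure d, (A y).IsSymm := hpos.mono fun y hy => hy.isHermitian
  have hnorm : ⟪H2.toL2CLM (H2.const d), H2.toL2CLM (H2.const d)⟫_ℂ = 1 := by
    rw [H2.toL2CLM_apply, H2.inner_const_left, H2.toL2_const, expBasis_repr_expL2, if_pos rfl]
  obtain ⟨l, φ, hl, hφ, hleast⟩ := exists_contDiffAt_least_eigenpair (n := ω) (by simp)
    (contDiff_blochOp hA ρ).contDiffAt (isSymmetric_blochOp hA hsymm ρ) (blochOp_zero_const hA ρ)
    hnorm (by positivity : 0 < min (ρ ^ 2 / 4) 1) (coercive_blochOp_zero hA hpos ρ)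
  simp only [isVariationalEigenpair_blochOp_iff] at hleast
  have hIsLeast : ∀ᶠ η in 𝓝 0, IsLeast (blochEigenvalues A ρ η) (l η) :=
    hleast.mono fun η h => ⟨⟨φ η, h.1⟩, fun μ ⟨ψ, hψ⟩ => h.2 μ ψ hψ⟩
  have hfirst : firstBlochEigenvalue A ρ =ᶠ[𝓝 0] l := hIsLeast.mono fun η h => h.csInf_eq
  refine ⟨φ, hl.analyticAt.congr hfirst.symm, hφ.analyticAt, ?_⟩
  filter_upwards [hleast, hIsLeast, hfirst] with η hpair hmin heq
  exact heq ▸ ⟨hmin, hpair.1⟩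

theorem IsCoefficientMatrix.memLp_entry (hA : IsCoefficientMatrix A) (j k : Fin d) :
    MemLp (fun y => A y j k) ∞ (cellMeasure d) := by
  obtain ⟨M, hM⟩ := hA.bounded
  exact memLp_top_of_bound (hA.measurable j k).restrict.aestronglyMeasurable M
    (ae_restrict_of_ae (hM.mono fun y hy => hy j k))

theorem IsCoefficientMatrix.ae_posSemidef (hA : IsCoefficientMatrix A) :
    ∀ᵐ y ∂cellMeasure d, (A y).PosSemidef := by
  obtain ⟨α, hα, hell⟩ := hA.elliptic
  filter_upwards [ae_restrict_of_ae hA.symmetric, ae_restrict_of_ae hell] with y hsymm hy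
  refine .of_dotProduct_mulVec_nonneg hsymm fun ξ => ?_
  rw [star_trivial, dotProduct_comm]
  exact (mul_nonneg hα.le (dotProduct_self_star_nonneg ξ)).trans (hy ξ)

theorem ball_subset_dualCell {δ : ℝ} (hδ : δ ≤ 1 / 2) :
    Metric.ball (0 : EuclideanSpace ℝ (Fin d)) δ ⊆ dualCell d := fun η hη j => by
  have hj : |η j| < 1 / 2 :=
    (PiLp.norm_apply_le η j).trans_lt ((mem_ball_zero_iff.mp hη).trans_le hδ)
  exact ⟨(abs_lt.mp hj).1.le, (abs_lt.mp hj).2⟩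

end FirstEigenvalue

end BlochWave

end

theorem theorem3p1_general (d : ℕ) (A : (Fin d → ℝ) → Matrix (Fin d) (Fin d) ℝ)
    (hA : ∀ j k, MemLp (fun y => A y j k) ∞ (BlochWave.cellMeasure d))
    (hpos : ∀ᵐ y ∂BlochWave.cellMeasure d, (A y).PosSemidef) (ρ : ℝ) (hρ : ρ ≠ 0) :
    ∃ δ : ℝ, 0 < δ ∧
      Metric.ball (0 : EuclideanSpace ℝ (Fin d)) δ ⊆ BlochWave.dualCell d ∧
      (∀ η ∈ Metric.ball (0 : EuclideanSpace ℝ (Fin d)) δ,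
        IsLeast (BlochWave.blochEigenvalues A ρ η) (BlochWave.firstBlochEigenvalue A ρ η)) ∧
      AnalyticOnNhd ℝ (BlochWave.firstBlochEigenvalue A ρ)
        (Metric.ball (0 : EuclideanSpace ℝ (Fin d)) δ) ∧
      ∃ φ : EuclideanSpace ℝ (Fin d) → BlochWave.H2 d,
        AnalyticOnNhd ℝ φ (Metric.ball (0 : EuclideanSpace ℝ (Fin d)) δ) ∧
        ∀ η ∈ Metric.ball (0 : EuclideanSpace ℝ (Fin d)) δ,
          BlochWave.IsBlochEigenpair A ρ η (BlochWave.firstBlochEigenvalue A ρ η) (φ η) := by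
  obtain ⟨φ, hl, hφ, hleast⟩ := BlochWave.exists_analyticAt_firstBlochEigenpair hA hpos hρ
  obtain ⟨ε, hε, hball⟩ := Metric.eventually_nhds_iff_ball.mp
    (hl.eventually_analyticAt.and (hφ.eventually_analyticAt.and hleast))
  have hsub : Metric.ball 0 (min ε (1 / 2)) ⊆ Metric.ball (0 : EuclideanSpace ℝ (Fin d)) ε :=
    Metric.ball_subset_ball (min_le_left _ _)
  exact ⟨min ε (1 / 2), by positivity, BlochWave.ball_subset_dualCell (min_le_right _ _),
    fun η hη => (hball η (hsub hη)).2.2.1, fun η hη => (hball η (hsub hη)).1,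
    φ, fun η hη => (hball η (hsub hη)).2.1, fun η hη => (hball η (hsub hη)).2.2.2⟩

theorem theorem3p1 (d : ℕ) (A : (Fin d → ℝ) → Matrix (Fin d) (Fin d) ℝ)
    (hA : BlochWave.IsCoefficientMatrix A) (ρ : ℝ) (hρ : 0 < ρ) :
    ∃ δ : ℝ, 0 < δ ∧
      Metric.ball (0 : EuclideanSpace ℝ (Fin d)) δ ⊆ BlochWave.dualCell d ∧
      (∀ η ∈ Metric.ball (0 : EuclideanSpace ℝ (Fin d)) δ,
        IsLeast (BlochWave.blochEigenvalues A ρ η) (BlochWave.firstBlochEigenvalue A ρ η)) ∧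
      AnalyticOnNhd ℝ (BlochWave.firstBlochEigenvalue A ρ)
        (Metric.ball (0 : EuclideanSpace ℝ (Fin d)) δ) ∧
      ∃ φ : EuclideanSpace ℝ (Fin d) → BlochWave.H2 d,
        AnalyticOnNhd ℝ φ (Metric.ball (0 : EuclideanSpace ℝ (Fin d)) δ) ∧
        ∀ η ∈ Metric.ball (0 : EuclideanSpace ℝ (Fin d)) δ,
          BlochWave.IsBlochEigenpair A ρ η (BlochWave.firstBlochEigenvalue A ρ η) (φ η) :=
  theorem3p1_general d A hA.memLp_entry hA.ae_posSemidef ρ hρ.ne'
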